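/- A quantum circuit is a sequence of layers, each consisting of elementary gates acting on pairwise disjoint sets of qubits; its depth is the number of layers. The elementary gates are $\mathrm{NOT}$, $\mathrm{CNOT}$, Toffoli, the phase rotations $R_\theta=\mathrm{diag}(1,e^{i\theta})$ and the controlled phase rotations $CR_\theta=\mathrm{diag}(1,1,1,e^{i\theta})$ with arbitrary $\theta\in\mathbb{R}$. A circuit on data qubits together with $a$ ancilla qubits implements an operator $U$ on the data qubits if it maps $|\psi\rangle|0^a\rangle$ to $(U|\psi\rangle)|0^a\rangle$ for every state $|\psi\rangle$ of the data qubits. For $\phi\in\mathbb{R}$ let $$\mathsf{PhaseProduct}(\phi)\,|x\rangle|z\rangle=e^{i\phi xz}\,|x\rangle|z\rangle,\qquad \mathsf{PhaseTripleProduct}(\phi)\,|x\rangle|y\rangle|z\rangle=e^{i\phi xyz}\,|x\rangle|y\rangle|z\rangle,$$ where $x,y,z$ are the non-negative integers stored in binary in the respective registers. Let $k\ge 2$ be an integer. Then there is a constant $C$, depending only on $k$, such that for every $n$, all register lengths at most $n$ and every $\phi\in\mathbb{R}$: (i) $\mathsf{PhaseProduct}(\phi)$ is implemented by a circuit of depth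 at most $C\,n^{\log_k 2}$ with at most $C\,n$ ancilla qubits; (ii) $\mathsf{PhaseTripleProduct}(\phi)$ is implemented by a circuit of depth at most $C\,n^{\log_k 3}$ with at most $C\,n$ ancilla qubits. -/

import Mathlib

namespace PhaseCircuit

/-- Elementary gates on a set `W` of wires (qubits): NOT, CNOT, Toffoli, the phase rotation
`R_θ = diag(1, e^{iθ})` and the controlled phase rotation `CR_θ = diag(1, 1, 1, e^{iθ})`,
where `θ` is an arbitrary real angle. -/
inductive Gate (W : Type) : Type where
  | not (t : W)
  | cnot (c t : W)
  | toffoli (c₁ c₂ t : W)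
  | phase (θ : ℝ) (t : W)
  | cphase (θ : ℝ) (c t : W)

namespace Gate

variable {W : Type}

/-- The wires on which a gate acts. -/
def wires : Gate W → List W
  | not t => [t]
  | cnot c t => [c, t]
  | toffoli c₁ c₂ t => [c₁, c₂, t]
  | phase _ t => [t]
  | cphase _ c t => [c, t]

/-- A gate maps the basis state `|b⟩` to `e^{i (g.angle b)} |g.flip b⟩`;
this is the classical part `b ↦ g.flip b`. -/
def flip [DecidableEq W] : Gate W → (W → Bool) → (W → Bool)
  | not t, b => Function.update b t (!b t)
  | cnot c t, b => Function.update b t (xor (b t) (b c))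
  | toffoli c₁ c₂ t, b => Function.update b t (xor (b t) (b c₁ && b c₂))
  | phase _ _, b => b
  | cphase _ _ _, b => b

/-- The phase that a gate applies to the basis state `|b⟩`. -/
def angle : Gate W → (W → Bool) → ℝ
  | phase θ t, b => if b t then θ else 0
  | cphase θ c t, b => if b c && b t then θ else 0
  | _, _ => 0

/-- The operator of a gate on the full state space, in the computational basis. -/
noncomputable def unitary [Fintype W] [DecidableEq W] (g : Gate W) :
    Matrix (W → Bool) (W → Bool) ℂ :=
  Matrix.of fun b' b => if b' = g.flip b then Complex.exp (Complex.I * (g.angle b : ℂ)) else 0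

end Gate

/-- A quantum circuit on the wires `W`: a sequence of layers (in order of time), each of which is
a collection of gates acting on pairwise disjoint sets of wires (and each gate of which acts on
distinct wires). -/
structure Circuit (W : Type) : Type where
  layers : List (List (Gate W))
  disjoint : ∀ L ∈ layers, (L.flatMap Gate.wires).Nodup

namespace Circuit

/-- The depth is the number of layers. -/
def depth {W : Type} (c : Circuit W) : ℕ := c.layers.length

/-- The operator of a circuit: the product of its gates, the earliest gate acting first. -/
noncomputable def unitary {W : Type} [Fintype W] [DecidableEq W] (c : Circuit W) :
    Matrix (W → Bool) (W → Bool) ℂ :=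
  c.layers.flatten.foldl (fun U g => g.unitary * U) 1

end Circuit

/-- The state `|ψ⟩ ⊗ |0…0⟩`, with data wires `D` in state `ψ` and all ancilla wires `A` in `|0⟩`. -/
def withAncillas {D A : Type} [Fintype A] (ψ : (D → Bool) → ℂ) : (D ⊕ A → Bool) → ℂ :=
  fun b => if ∀ a : A, b (Sum.inr a) = false then ψ (fun d => b (Sum.inl d)) else 0

/-- The circuit `c` on data wires `D` and ancilla wires `A` implements the operator `U` on the data
wires: with the ancillas initialised to `|0⟩`, it applies `U` exactly to every data state and
returns the ancillas to `|0⟩`. -/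
def Circuit.Implements {D A : Type} [Fintype D] [DecidableEq D] [Fintype A] [DecidableEq A]
    (c : Circuit (D ⊕ A)) (U : Matrix (D → Bool) (D → Bool) ℂ) : Prop :=
  ∀ ψ : (D → Bool) → ℂ, c.unitary.mulVec (withAncillas ψ) = withAncillas (U.mulVec ψ)

/-- The integer held by an `n`-qubit register, wire `i` being the bit of weight `2 ^ i`. -/
def regValue {n : ℕ} (b : Fin n → Bool) : ℕ := ∑ i : Fin n, (b i).toNat * 2 ^ (i : ℕ)

/-- `PhaseProduct(φ) |x⟩|z⟩ = exp(i φ x z) |x⟩|z⟩` on registers of `p` and `q` qubits. -/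
noncomputable def phaseProduct (p q : ℕ) (φ : ℝ) :
    Matrix (Fin p ⊕ Fin q → Bool) (Fin p ⊕ Fin q → Bool) ℂ :=
  Matrix.diagonal fun b =>
    Complex.exp (Complex.I * φ
      * (regValue fun i => b (Sum.inl i) : ℕ)
      * (regValue fun i => b (Sum.inr i) : ℕ))

/-- `PhaseTripleProduct(φ) |x⟩|y⟩|z⟩ = exp(i φ x y z) |x⟩|y⟩|z⟩` on registers of `p`, `q` and `r`
qubits. -/
noncomputable def phaseTripleProduct (p q r : ℕ) (φ : ℝ) :
    Matrix (Fin p ⊕ Fin q ⊕ Fin r → Bool) (Fin p ⊕ Fin q ⊕ Fin r → Bool) ℂ :=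
  Matrix.diagonal fun b =>
    Complex.exp (Complex.I * φ
      * (regValue fun i => b (Sum.inl i) : ℕ)
      * (regValue fun i => b (Sum.inr (Sum.inl i)) : ℕ)
      * (regValue fun i => b (Sum.inr (Sum.inr i)) : ℕ))

end PhaseCircuit

/-!
NOT, CNOT and Toffoli gates permute the basis states and phase gates multiply them by phases, so it
suffices to follow basis states and to collect phases. The phases `φ * ∏ f, x f` of products of
numbers are treated by the method of Toom and Cook: cut each `x f` into `K` blocks, the coefficients
of a polynomial. The product is then a linear combination of the products of the values of these
polynomials at `card F * K` points, so one computes such values into ancillas, applies the phase of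
their product recursively, and uncomputes.

Storing numbers in redundant digits, with pending carries, makes the evaluation local: its depth is
a constant depending on `K` only. Treating `K - 1` points at a time keeps the number of ancillas
linear, since the `K - 1` subproblems are `K` times smaller, and takes at most `2 * card F` rounds.
The depth is therefore `O (n ^ (log (2 * card F) / log K))`. As `K` is at our disposal, the exponent
can be any positive number.
-/

namespace PhaseCircuit

open Function

/-! ### Gate lists -/

section GateList

variable {V W : Type}

/-- The classical part of the action of a list of gates on a basis state. -/
def runGates [DecidableEq W] : List (Gate W) → (W → Bool) → (W → Bool)
  | [], b => b
  | g :: l, b => runGates l (g.flip b)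

/-- The phase that a list of gates applies to a basis state. -/
def totalAngle [DecidableEq W] : List (Gate W) → (W → Bool) → ℝ
  | [], _ => 0
  | g :: l, b => g.angle b + totalAngle l (g.flip b)

/-- The gate `g` with its wires renamed along `e`. -/
def Gate.map (e : V → W) : Gate V → Gate W
  | .not t => .not (e t)
  | .cnot c t => .cnot (e c) (e t)
  | .toffoli c₁ c₂ t => .toffoli (e c₁) (e c₂) (e t)
  | .phase θ t => .phase θ (e t)
  | .cphase θ c t => .cphase θ (e c) (e t)

theorem Gate.wires_map (e : V → W) (g : Gate V) : (g.map e).wires = g.wires.map e := by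
  cases g <;> rfl

theorem Gate.angle_map (e : V → W) (g : Gate V) (b : W → Bool) :
    (g.map e).angle b = g.angle (b ∘ e) := by
  cases g <;> rfl

variable [DecidableEq W]

@[simp] theorem runGates_nil (b : W → Bool) : runGates [] b = b := rfl

@[simp] theorem runGates_cons (g : Gate W) (l : List (Gate W)) (b : W → Bool) :
    runGates (g :: l) b = runGates l (g.flip b) := rfl

@[simp] theorem totalAngle_nil (b : W → Bool) : totalAngle [] b = 0 := rfl

@[simp] theorem totalAngle_cons (g : Gate W) (l : List (Gate W)) (b : W → Bool) :
    totalAngle (g :: l) b = g.angle b + totalAngle l (g.flip b) := rfl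

@[simp] theorem runGates_append (l₁ l₂ : List (Gate W)) (b : W → Bool) :
    runGates (l₁ ++ l₂) b = runGates l₂ (runGates l₁ b) := by
  induction l₁ generalizing b with
  | nil => rfl
  | cons g l ih => simp [ih]

@[simp] theorem totalAngle_append (l₁ l₂ : List (Gate W)) (b : W → Bool) :
    totalAngle (l₁ ++ l₂) b = totalAngle l₁ b + totalAngle l₂ (runGates l₁ b) := by
  induction l₁ generalizing b with
  | nil => simp
  | cons g l ih => simp [ih, add_assoc]

theorem Gate.flip_map_apply [DecidableEq V] {e : V → W} (he : Injective e) (g : Gate V)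
    (b : W → Bool) (v : V) : (g.map e).flip b (e v) = g.flip (b ∘ e) v := by
  cases g <;> simp [Gate.map, Gate.flip, update_apply, he.eq_iff]

theorem Gate.flip_map_of_notMem_range {e : V → W} (g : Gate V) (b : W → Bool) {w : W}
    (hw : ¬∃ v, e v = w) : (g.map e).flip b w = b w := by
  have ne (v : V) : w ≠ e v := fun h => hw ⟨v, h.symm⟩
  cases g <;> simp [Gate.map, Gate.flip, ne]

end GateList

/-! ### Gates acting on disjoint blocks of wires -/

section Blocks

variable {I V W : Type}

/-- A list of gates, each tagged with the block of wires it acts on; `e` places the blocks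
disjointly among the wires `W`. -/
def placeGates (e : I × V ↪ W) (l : List (I × Gate V)) : List (Gate W) :=
  l.map fun p => p.2.map fun v => e (p.1, v)

/-- The gates that a tagged list applies to the block `i`. -/
def gatesOn [DecidableEq I] (i : I) (l : List (I × Gate V)) : List (Gate V) :=
  (l.filter (·.1 = i)).map Prod.snd

section

variable [DecidableEq I]

@[simp] theorem gatesOn_cons (i : I) (p : I × Gate V) (l : List (I × Gate V)) :
    gatesOn i (p :: l) = if p.1 = i then p.2 :: gatesOn i l else gatesOn i l := by
  by_cases h : p.1 = i <;> simp [gatesOn, h]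

theorem gatesOn_flatMap {J : Type} (i : I) (s : List J) (G : J → List (I × Gate V)) :
    gatesOn i (s.flatMap G) = s.flatMap fun j => gatesOn i (G j) := by
  simp [gatesOn, List.filter_flatMap, List.map_flatMap]

theorem gatesOn_flatMap_tag {s : List I} (hs : s.Nodup) (G : I → List (Gate V)) (i : I) :
    gatesOn i (s.flatMap fun j => (G j).map (Prod.mk j)) = if i ∈ s then G i else [] := by
  have gatesOn_tag (j : I) : gatesOn i ((G j).map (Prod.mk j)) = if j = i then G j else [] := by
    by_cases h : j = i <;> simp [gatesOn, List.filter_map, Function.comp_def, h]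
  simp only [gatesOn_flatMap, gatesOn_tag]
  induction s with
  | nil => rfl
  | cons j s ih =>
    rw [List.nodup_cons] at hs
    rw [List.flatMap_cons, ih hs.2]
    by_cases h : j = i
    · subst h
      simp [hs.1]
    · simp [h, Ne.symm h]

end

theorem nodup_wires_placeGates (e : I × V ↪ W) {s : List I} (hs : s.Nodup)
    (G : I → List (Gate V)) (hG : ∀ i, ((G i).flatMap Gate.wires).Nodup) :
    ((placeGates e (s.flatMap fun i => (G i).map (Prod.mk i))).flatMap Gate.wires).Nodup := by
  have wires_eq : (placeGates e (s.flatMap fun i => (G i).map (Prod.mk i))).flatMap Gate.wires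
      = s.flatMap fun i => ((G i).flatMap Gate.wires).map fun v => e (i, v) := by
    simp [placeGates, List.flatMap_assoc, List.flatMap_map, List.map_flatMap, Gate.wires_map]
  rw [wires_eq, List.nodup_flatMap]
  refine ⟨fun i _ => (hG i).map fun v v' h => by simpa using h, hs.imp fun {i j} hij w hi hj => ?_⟩
  obtain ⟨v, -, rfl⟩ := List.mem_map.1 hi
  obtain ⟨v', -, h⟩ := List.mem_map.1 hj
  exact hij (Prod.mk.inj (e.injective h)).1.symm

variable [DecidableEq I] [DecidableEq V] [DecidableEq W] (e : I × V ↪ W)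

theorem Gate.flip_map_place (i j : I) (g : Gate V) (b : W → Bool) :
    (fun v => (g.map fun v => e (i, v)).flip b (e (j, v)))
      = if i = j then g.flip fun v => b (e (j, v)) else fun v => b (e (j, v)) := by
  funext v
  by_cases hij : i = j
  · subst hij
    have inj : Injective fun v => e (i, v) := fun v v' h => by simpa using h
    simpa [Function.comp_def] using g.flip_map_apply inj b v
  · rw [Gate.flip_map_of_notMem_range] <;> simp [hij]

theorem runGates_placeGates (l : List (I × Gate V)) (b : W → Bool) :
    runGates (placeGates e l) b
      = extend e (fun p => runGates (gatesOn p.1 l) (fun v => b (e (p.1, v))) p.2) b := by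
  induction l generalizing b with
  | nil =>
    funext w
    by_cases hw : ∃ p, e p = w
    · obtain ⟨p, rfl⟩ := hw
      simp [placeGates, gatesOn, e.injective.extend_apply]
    · simp [placeGates, extend_apply' _ _ _ hw]
  | cons g l ih =>
    funext w
    rw [placeGates, List.map_cons, runGates_cons, ← placeGates, ih]
    by_cases hw : ∃ p, e p = w
    · obtain ⟨⟨j, v⟩, rfl⟩ := hw
      simp only [e.injective.extend_apply, Gate.flip_map_place, gatesOn_cons]
      split_ifs <;> rfl
    · rw [extend_apply' _ _ _ hw, extend_apply' _ _ _ hw, Gate.flip_map_of_notMem_range]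
      exact fun ⟨v, hv⟩ => hw ⟨_, hv⟩

theorem totalAngle_placeGates [Fintype I] (l : List (I × Gate V)) (b : W → Bool) :
    totalAngle (placeGates e l) b = ∑ i, totalAngle (gatesOn i l) fun v => b (e (i, v)) := by
  induction l generalizing b with
  | nil => simp [placeGates, gatesOn]
  | cons g l ih =>
    rw [placeGates, List.map_cons, totalAngle_cons, ← placeGates, ih, Gate.angle_map]
    have split (i : I) : totalAngle (gatesOn i (g :: l)) (fun v => b (e (i, v)))
        = (if g.1 = i then g.2.angle fun v => b (e (i, v)) else 0)
          + totalAngle (gatesOn i l)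
              fun v => (g.2.map fun v => e (g.1, v)).flip b (e (i, v)) := by
      rw [Gate.flip_map_place, gatesOn_cons]
      split_ifs <;> simp
    simp only [split, Finset.sum_add_distrib, Finset.sum_ite_eq, Finset.mem_univ, if_true]
    rfl

end Blocks

/-! ### Operations on circuits -/

theorem flatten_map_getD_range {α : Type*} {l : List (List α)} {n : ℕ} (h : l.length ≤ n) :
    ((List.range n).map (l.getD · [])).flatten = l.flatten := by
  induction l generalizing n with
  | nil => simp
  | cons a l ih =>
    obtain ⟨n, rfl⟩ := Nat.exists_eq_succ_of_ne_zero (Nat.ne_of_gt (Nat.lt_of_lt_of_le (by simp) h))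
    have tail_eq := ih (Nat.le_of_succ_le_succ h)
    simp [List.range_succ_eq_map, Function.comp_def, ← tail_eq]

namespace Circuit

variable {I V W : Type}

/-- The classical part of the action of a circuit on a basis state. -/
def run [DecidableEq W] (c : Circuit W) (b : W → Bool) : W → Bool := runGates c.layers.flatten b

/-- The phase that a circuit applies to a basis state. -/
def angle [DecidableEq W] (c : Circuit W) (b : W → Bool) : ℝ := totalAngle c.layers.flatten b

/-- The circuit with a single gate in each layer. -/
def ofGates (l : List (Gate W)) (hl : ∀ g ∈ l, g.wires.Nodup) : Circuit W where
  layers := l.map fun g => [g]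
  disjoint := by simpa using hl

/-- Sequential composition; `c₁` acts first. -/
def append (c₁ c₂ : Circuit W) : Circuit W where
  layers := c₁.layers ++ c₂.layers
  disjoint L hL := (List.mem_append.1 hL).elim (c₁.disjoint L) (c₂.disjoint L)

@[simp] theorem depth_ofGates (l : List (Gate W)) (hl) : (ofGates l hl).depth = l.length := by
  simp [ofGates, depth]

@[simp] theorem depth_append (c₁ c₂ : Circuit W) : (c₁.append c₂).depth = c₁.depth + c₂.depth := by
  simp [append, depth]

section

variable [DecidableEq W]

@[simp] theorem run_ofGates (l : List (Gate W)) (hl) : (ofGates l hl).run = runGates l := by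
  funext b
  simp [ofGates, run, ← List.flatMap_def]

@[simp] theorem angle_ofGates (l : List (Gate W)) (hl) : (ofGates l hl).angle = totalAngle l := by
  funext b
  simp [ofGates, angle, ← List.flatMap_def]

@[simp] theorem run_append (c₁ c₂ : Circuit W) (b : W → Bool) :
    (c₁.append c₂).run b = c₂.run (c₁.run b) := by
  simp [append, run]

@[simp] theorem angle_append (c₁ c₂ : Circuit W) (b : W → Bool) :
    (c₁.append c₂).angle b = c₁.angle b + c₂.angle (c₁.run b) := by
  simp [append, run, angle]

end

section Parallel

variable [Fintype I]

/-- The `t`-th layers of the circuits `c i`, tagged with their blocks; a circuit that has already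
finished contributes no gates. -/
noncomputable def taggedLayer (c : I → Circuit V) (t : ℕ) : List (I × Gate V) :=
  Finset.univ.toList.flatMap fun i => ((c i).layers.getD t []).map (Prod.mk i)

/-- The circuits `c i` acting in parallel, `c i` on the block of wires `fun v => e (i, v)`. -/
noncomputable def parallel (e : I × V ↪ W) (c : I → Circuit V) : Circuit W where
  layers := (List.range (Finset.univ.sup fun i => (c i).depth)).map
    fun t => placeGates e (taggedLayer c t)
  disjoint := by
    simp only [List.forall_mem_map]
    refine fun t _ => nodup_wires_placeGates e (Finset.nodup_toList _) _ fun i => ?_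
    by_cases ht : t < (c i).layers.length
    · rw [List.getD_eq_getElem _ _ ht]
      exact (c i).disjoint _ (List.getElem_mem ht)
    · simp [ht]

theorem depth_parallel (e : I × V ↪ W) (c : I → Circuit V) :
    (parallel e c).depth = Finset.univ.sup fun i => (c i).depth := by
  simp [parallel, depth]

theorem depth_parallel_le (e : I × V ↪ W) {c : I → Circuit V} {d : ℕ} (h : ∀ i, (c i).depth ≤ d) :
    (parallel e c).depth ≤ d := by
  simpa [depth_parallel] using h

theorem flatten_layers_parallel (e : I × V ↪ W) (c : I → Circuit V) :
    (parallel e c).layers.flatten = placeGates e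
      ((List.range (Finset.univ.sup fun i => (c i).depth)).map (taggedLayer c)).flatten := by
  simp [parallel, placeGates, List.map_flatten, Function.comp_def]

theorem gatesOn_taggedLayers [DecidableEq I] (c : I → Circuit V) (i : I) :
    gatesOn i ((List.range (Finset.univ.sup fun i => (c i).depth)).map (taggedLayer c)).flatten
      = (c i).layers.flatten := by
  have hi : (c i).layers.length ≤ Finset.univ.sup fun i => (c i).depth :=
    Finset.le_sup (f := fun i => (c i).depth) (Finset.mem_univ i)
  rw [← List.flatMap_def, gatesOn_flatMap, ← flatten_map_getD_range hi, List.flatMap_def]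
  simp [taggedLayer, gatesOn_flatMap_tag (Finset.nodup_toList _)]

variable [DecidableEq V] [DecidableEq W] (e : I × V ↪ W) (c : I → Circuit V) (b : W → Bool)

theorem run_parallel : (parallel e c).run b
    = extend e (fun p => (c p.1).run (fun v => b (e (p.1, v))) p.2) b := by
  classical
  rw [run, flatten_layers_parallel, runGates_placeGates]
  simp only [gatesOn_taggedLayers, run]

theorem angle_parallel : (parallel e c).angle b = ∑ i, (c i).angle fun v => b (e (i, v)) := by
  classical
  rw [angle, flatten_layers_parallel, totalAngle_placeGates]
  simp only [gatesOn_taggedLayers, angle]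

end Parallel

/-- The circuit `c` with its wires renamed along `e`. -/
noncomputable def map (e : V ↪ W) (c : Circuit V) : Circuit W :=
  parallel ((Equiv.punitProd V).toEmbedding.trans e) fun _ => c

@[simp] theorem depth_map (e : V ↪ W) (c : Circuit V) : (c.map e).depth = c.depth := by
  simp [map, depth_parallel]

variable [DecidableEq V] [DecidableEq W]

theorem run_map (e : V ↪ W) (c : Circuit V) (b : W → Bool) :
    (c.map e).run b = extend e (c.run (b ∘ e)) b := by
  funext w
  rw [map, run_parallel]
  by_cases hw : ∃ v, e v = w
  · obtain ⟨v, rfl⟩ := hw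
    rw [e.injective.extend_apply]
    exact (Embedding.injective _).extend_apply _ _ (PUnit.unit, v)
  · rw [extend_apply' _ _ _ hw, extend_apply']
    exact fun ⟨p, hp⟩ => hw ⟨p.2, hp⟩

theorem angle_map (e : V ↪ W) (c : Circuit V) (b : W → Bool) :
    (c.map e).angle b = c.angle (b ∘ e) := by
  rw [map, angle_parallel]
  simp [Function.comp_def]

end Circuit

/-! ### The operator of a circuit -/

section MonomialMatrix

variable {B W : Type}

/-- The operator sending the basis state `|b⟩` to `e^{i α b} |σ b⟩`. -/
noncomputable def monomialMatrix [DecidableEq B] (σ : B → B) (α : B → ℝ) : Matrix B B ℂ :=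
  Matrix.of fun b' b => if b' = σ b then Complex.exp (Complex.I * (α b : ℂ)) else 0

theorem monomialMatrix_mul [Fintype B] [DecidableEq B] (σ τ : B → B) (α β : B → ℝ) :
    monomialMatrix σ α * monomialMatrix τ β
      = monomialMatrix (σ ∘ τ) fun b => β b + α (τ b) := by
  ext b' b
  rw [Matrix.mul_apply, Finset.sum_eq_single (τ b)]
  · by_cases h : b' = σ (τ b) <;>
      simp [monomialMatrix, h, mul_add, Complex.exp_add, mul_comm]
  · intro x _ hx
    simp [monomialMatrix, hx]
  · simp

theorem monomialMatrix_id_zero [DecidableEq B] :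
    monomialMatrix (id : B → B) (fun _ => 0) = 1 := by
  ext b' b
  simp [monomialMatrix, Matrix.one_apply]

variable [Fintype W] [DecidableEq W]

theorem foldl_gate_unitary (l : List (Gate W)) :
    l.foldl (fun U g => g.unitary * U) 1 = monomialMatrix (runGates l) (totalAngle l) := by
  induction l using List.reverseRecOn with
  | nil => exact monomialMatrix_id_zero.symm
  | append_singleton l g ih =>
    have gate_eq : g.unitary = monomialMatrix g.flip g.angle := rfl
    rw [List.foldl_append, List.foldl_cons, List.foldl_nil, ih, gate_eq, monomialMatrix_mul]
    congr 1 <;> funext b <;> simp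

theorem Circuit.unitary_eq_monomialMatrix (c : Circuit W) :
    c.unitary = monomialMatrix c.run c.angle :=
  foldl_gate_unitary _

end MonomialMatrix

/-! ### Circuits that apply phases or compute Boolean functions -/

theorem extend_eq_of_forall {α β γ : Type*} {e : α → β} (he : Injective e) {f : α → γ}
    {g g' : β → γ} (h : ∀ a, g' (e a) = f a) (h' : ∀ b, (¬∃ a, e a = b) → g' b = g b) :
    extend e f g = g' := by
  funext b
  by_cases hb : ∃ a, e a = b
  · obtain ⟨a, rfl⟩ := hb
    rw [he.extend_apply, h]
  · rw [extend_apply' _ _ _ hb, h' b hb]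

section Notions

variable {D A Y Z : Type} [DecidableEq D] [DecidableEq A] [DecidableEq Y] [DecidableEq Z]

/-- Started with all ancillas `A` in `|0⟩`, the circuit multiplies every basis state `|x⟩` of the
data by `e^{i θ x}` and leaves the ancillas in `|0⟩`. -/
def Circuit.AppliesPhase (c : Circuit (D ⊕ A)) (θ : (D → Bool) → ℝ) : Prop :=
  ∀ x, c.run (Sum.elim x fun _ => false) = Sum.elim x (fun _ => false) ∧
    c.angle (Sum.elim x fun _ => false) = θ x

/-- The circuit maps `|x⟩|y⟩|0⟩` to `|x⟩|y ⊕ g x⟩|0⟩`, the ancillas `Z` being initialised to `|0⟩`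
and returned to `|0⟩`. -/
def Circuit.ComputesInto (E : Circuit (D ⊕ Y ⊕ Z)) (g : (D → Bool) → Y → Bool) : Prop :=
  ∀ x y, E.run (Sum.elim x (Sum.elim y fun _ => false))
      = Sum.elim x (Sum.elim (fun j => xor (y j) (g x j)) fun _ => false) ∧
    E.angle (Sum.elim x (Sum.elim y fun _ => false)) = 0

/-- The phase `θ` can be applied by a circuit of depth at most `d` with `a` ancillas. -/
def Realizable (θ : (D → Bool) → ℝ) (d a : ℕ) : Prop :=
  ∃ c : Circuit (D ⊕ Fin a), c.depth ≤ d ∧ c.AppliesPhase θ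

theorem Circuit.AppliesPhase.implements [Fintype D] [Fintype A] {c : Circuit (D ⊕ A)}
    {θ : (D → Bool) → ℝ} (h : c.AppliesPhase θ) :
    c.Implements (Matrix.diagonal fun x => Complex.exp (Complex.I * (θ x : ℂ))) := by
  intro ψ
  funext b'
  have term_eq (b : D ⊕ A → Bool) : c.unitary b' b * withAncillas ψ b
      = if b' = b then
          Complex.exp (Complex.I * (θ fun d => b (Sum.inl d) : ℂ)) * withAncillas ψ b
        else 0 := by
    by_cases hb : ∀ a, b (Sum.inr a) = false
    · have b_eq : b = Sum.elim (fun d => b (Sum.inl d)) fun _ => false := by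
        funext w
        cases w <;> simp [hb]
      rw [b_eq, c.unitary_eq_monomialMatrix]
      simp [monomialMatrix, (h _).1, (h _).2]
    · simp [withAncillas, hb]
  rw [Matrix.mulVec, dotProduct, Finset.sum_congr rfl fun b _ => term_eq b]
  simp [withAncillas, Matrix.mulVec_diagonal]

end Notions

namespace Realizable

variable {D : Type} [DecidableEq D] {θ θ' : (D → Bool) → ℝ} {d d' a a' : ℕ}

theorem of_circuit {A : Type} [Fintype A] [DecidableEq A] {c : Circuit (D ⊕ A)}
    (h : c.AppliesPhase θ) (hd : c.depth ≤ d) (ha : Fintype.card A ≤ a) : Realizable θ d a := by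
  let e : D ⊕ A ↪ D ⊕ Fin a :=
    (Embedding.refl D).sumMap ((Fintype.equivFin A).toEmbedding.trans (Fin.castLEEmb ha))
  have zero_comp (x : D → Bool) :
      (Sum.elim x fun _ => false : D ⊕ Fin a → Bool) ∘ e = Sum.elim x fun _ => false := by
    funext w
    cases w <;> rfl
  refine ⟨c.map e, (c.depth_map _).trans_le hd, fun x => ⟨?_, ?_⟩⟩
  · rw [Circuit.run_map, zero_comp, (h x).1]
    exact extend_eq_of_forall e.injective (fun w => congrFun (zero_comp x) w) fun w _ => rfl
  · rw [Circuit.angle_map, zero_comp, (h x).2]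

theorem mono (h : Realizable θ d a) (hd : d ≤ d') (ha : a ≤ a') : Realizable θ d' a' :=
  let ⟨_, hc, hθ⟩ := h
  of_circuit hθ (hc.trans hd) (by simpa using ha)

theorem zero (a : ℕ) : Realizable (fun _ : D → Bool => 0) 0 a :=
  ⟨.ofGates [] (by simp), by simp, fun _ => by simp⟩

theorem add (h : Realizable θ d a) (h' : Realizable θ' d' a) :
    Realizable (fun x => θ x + θ' x) (d + d') a := by
  obtain ⟨c, hc, hθ⟩ := h
  obtain ⟨c', hc', hθ'⟩ := h'
  refine ⟨c.append c', by simpa using Nat.add_le_add hc hc', fun x => ?_⟩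
  simp [(hθ x).1, (hθ x).2, (hθ' x).1, (hθ' x).2]

theorem sum {ι : Type} [Fintype ι] {θ : ι → (D → Bool) → ℝ} (h : ∀ i, Realizable (θ i) d a) :
    Realizable (fun x => ∑ i, θ i x) (Fintype.card ι * d) a := by
  classical
  have sum_finset (s : Finset ι) : Realizable (fun x => ∑ i ∈ s, θ i x) (s.card * d) a := by
    induction s using Finset.induction_on with
    | empty => simpa using zero a
    | insert i s hi ih =>
      simp only [Finset.sum_insert hi, Finset.card_insert_of_notMem hi]
      exact ((h i).add ih).mono (by linarith) le_rfl
  exact sum_finset Finset.univ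

theorem parallel {I : Type} [Fintype I] [DecidableEq I] {θ : I → (D → Bool) → ℝ}
    (h : ∀ i, Realizable (θ i) d a) :
    Realizable (fun x : I × D → Bool => ∑ i, θ i fun y => x (i, y)) d (Fintype.card I * a) := by
  choose c hc hθ using h
  let e : I × (D ⊕ Fin a) ≃ I × D ⊕ I × Fin a := Equiv.prodSumDistrib I D (Fin a)
  have restrict (x : I × D → Bool) (i : I) :
      (fun v => (Sum.elim x fun _ => false : I × D ⊕ I × Fin a → Bool) (e (i, v)))
        = Sum.elim (fun y => x (i, y)) fun _ => false := by
    funext v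
    cases v <;> rfl
  have applies : (Circuit.parallel e.toEmbedding c).AppliesPhase
      fun x => ∑ i, θ i fun y => x (i, y) := fun x => by
    constructor
    · rw [Circuit.run_parallel]
      refine extend_eq_of_forall e.injective (fun p => ?_) fun _ _ => rfl
      exact (congrFun (restrict x p.1) p.2).trans
        (by simp only [Equiv.toEmbedding_apply, restrict, (hθ _ _).1])
    · rw [Circuit.angle_parallel]
      simp only [Equiv.toEmbedding_apply, restrict, (hθ _ _).2]
  exact of_circuit applies (Circuit.depth_parallel_le _ hc) (by simp)

/-- Compute `g x` into fresh ancillas, apply the phase there, and uncompute. -/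
theorem comp {Y Z : Type} [Fintype Y] [DecidableEq Y] [Fintype Z] [DecidableEq Z]
    {E : Circuit (D ⊕ Y ⊕ Z)} {g : (D → Bool) → Y → Bool} {θ : (Y → Bool) → ℝ}
    (hE : E.ComputesInto g) (h : Realizable θ d a) :
    Realizable (fun x => θ (g x)) (E.depth + d + E.depth)
      (Fintype.card Y + Fintype.card Z + a) := by
  obtain ⟨c, hc, hθ⟩ := h
  let eE : D ⊕ Y ⊕ Z ↪ D ⊕ (Y ⊕ Z) ⊕ Fin a :=
    Embedding.sumMap (Embedding.refl D) Embedding.inl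
  let ec : Y ⊕ Fin a ↪ D ⊕ (Y ⊕ Z) ⊕ Fin a :=
    (Embedding.sumMap Embedding.inl (Embedding.refl _)).trans Embedding.inr
  let state (x : D → Bool) (y : Y → Bool) : D ⊕ (Y ⊕ Z) ⊕ Fin a → Bool :=
    Sum.elim x (Sum.elim (Sum.elim y fun _ => false) fun _ => false)
  have state_comp_eE (x y) : state x y ∘ eE = Sum.elim x (Sum.elim y fun _ => false) := by
    funext w
    rcases w with _ | _ | _ <;> rfl
  have state_comp_ec (x y) : state x y ∘ ec = Sum.elim y fun _ => false := by
    funext w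
    rcases w with _ | _ <;> rfl
  have run_E (x y) : (E.map eE).run (state x y) = state x fun j => xor (y j) (g x j) := by
    rw [Circuit.run_map, state_comp_eE, (hE x y).1, ← state_comp_eE]
    refine extend_eq_of_forall eE.injective (fun _ => rfl) ?_
    rintro (w | w | w) hw
    · exact (hw ⟨.inl w, rfl⟩).elim
    · exact (hw ⟨.inr w, rfl⟩).elim
    · rfl
  have run_c (x y) : (c.map ec).run (state x y) = state x y := by
    rw [Circuit.run_map, state_comp_ec, (hθ y).1, ← state_comp_ec x]
    exact extend_eq_of_forall ec.injective (fun _ => rfl) fun _ _ => rfl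
  have angle_E (x y) : (E.map eE).angle (state x y) = 0 := by
    rw [Circuit.angle_map, state_comp_eE, (hE x y).2]
  have angle_c (x y) : (c.map ec).angle (state x y) = θ y := by
    rw [Circuit.angle_map, state_comp_ec, (hθ y).2]
  have applies : ((E.map eE).append ((c.map ec).append (E.map eE))).AppliesPhase
      fun x => θ (g x) := fun x => by
    have initial : (Sum.elim x fun _ => false) = state x fun _ => false := by
      funext w
      rcases w with _ | (_ | _) | _ <;> rfl
    simp [initial, run_E, run_c, angle_E, angle_c]
  refine of_circuit applies ?_ (by simp)
  simp only [Circuit.depth_append, Circuit.depth_map]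
  omega

theorem extend [Fintype D] {D' : Type} [DecidableEq D'] (ι : D' ↪ D) (h : Realizable θ d a) :
    Realizable (fun x : D' → Bool => θ (Function.extend ι x fun _ => false)) d
      (Fintype.card D + a) := by
  obtain ⟨c, hc, hθ⟩ := h
  let split : D ↪ D' ⊕ D := ⟨Function.extend ι Sum.inl Sum.inr, fun w w' hww' => by
    by_cases hw : ∃ v, ι v = w <;> by_cases hw' : ∃ v, ι v = w'
    · obtain ⟨⟨v, rfl⟩, ⟨v', rfl⟩⟩ := And.intro hw hw'
      simpa [ι.injective.extend_apply] using hww'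
    · obtain ⟨v, rfl⟩ := hw
      simp [ι.injective.extend_apply, extend_apply' _ _ _ hw'] at hww'
    · obtain ⟨v, rfl⟩ := hw'
      simp [ι.injective.extend_apply, extend_apply' _ _ _ hw] at hww'
    · simpa [extend_apply' _ _ _ hw, extend_apply' _ _ _ hw'] using hww'⟩
  let e : D ⊕ Fin a ↪ D' ⊕ D ⊕ Fin a :=
    (split.sumMap (Embedding.refl _)).trans (Equiv.sumAssoc D' D (Fin a)).toEmbedding
  have assoc (x : D' → Bool) (p : D' ⊕ D) :
      (Sum.elim x fun _ => false : D' ⊕ D ⊕ Fin a → Bool) (Equiv.sumAssoc _ _ _ (.inl p))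
        = Sum.elim x (fun _ => false) p := by
    cases p <;> rfl
  have restrict (x : D' → Bool) : (Sum.elim x fun _ => false : D' ⊕ D ⊕ Fin a → Bool) ∘ e
      = Sum.elim (Function.extend ι x fun _ => false) fun _ => false := by
    funext w
    rcases w with w | w
    · exact (assoc x _).trans (apply_extend (Sum.elim x fun _ => false) ι Sum.inr w)
    · rfl
  refine of_circuit (c := c.map e) (fun x => ⟨?_, ?_⟩) ((c.depth_map e).trans_le hc) (by simp)
  · rw [Circuit.run_map, restrict, (hθ _).1, ← restrict]
    exact extend_eq_of_forall e.injective (fun _ => rfl) fun _ _ => rfl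
  · rw [Circuit.angle_map, restrict, (hθ _).2]

end Realizable

theorem Circuit.ComputesInto.parallel {I X Y Z D Y' : Type} [Finite I] [DecidableEq I]
    [DecidableEq X] [DecidableEq Y] [DecidableEq Z] [DecidableEq D] [DecidableEq Y']
    (eX : I × X ↪ D) (eY : I × Y ↪ Y') {E : Circuit (X ⊕ Y ⊕ Z)} {g : (X → Bool) → Y → Bool}
    (h : E.ComputesInto g) :
    ∃ E' : Circuit (D ⊕ Y' ⊕ I × Z), E'.depth ≤ E.depth ∧ E'.ComputesInto
      fun u => Function.extend eY (fun p => g (fun x => u (eX (p.1, x))) p.2) fun _ => false := by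
  have := Fintype.ofFinite I
  let e : I × (X ⊕ Y ⊕ Z) ↪ D ⊕ Y' ⊕ I × Z :=
    ((Equiv.prodSumDistrib I X (Y ⊕ Z)).trans
      (Equiv.sumCongr (Equiv.refl _) (Equiv.prodSumDistrib I Y Z))).toEmbedding.trans
      (eX.sumMap (eY.sumMap (Embedding.refl _)))
  have restrict (u : D → Bool) (y : Y' → Bool) (i : I) :
      (fun v => (Sum.elim u (Sum.elim y fun _ => false) : D ⊕ Y' ⊕ I × Z → Bool) (e (i, v)))
        = Sum.elim (fun x => u (eX (i, x))) (Sum.elim (fun j => y (eY (i, j))) fun _ => false) := by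
    funext v
    rcases v with _ | _ | _ <;> rfl
  refine ⟨Circuit.parallel e fun _ => E, Circuit.depth_parallel_le _ fun _ => le_rfl,
    fun u y => ⟨?_, ?_⟩⟩
  · rw [Circuit.run_parallel]
    refine extend_eq_of_forall e.injective ?_ ?_
    · rintro ⟨i, v⟩
      rw [restrict, (h _ _).1]
      rcases v with x | j | z
      · rfl
      · exact congrArg (xor _) (eY.injective.extend_apply _ _ (i, j))
      · rfl
    · rintro (w | w | w) hw
      · rfl
      · refine (congrArg (xor _) (extend_apply' _ _ _ ?_)).trans (Bool.xor_false _)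
        rintro ⟨⟨i, j⟩, rfl⟩
        exact hw ⟨(i, .inr (.inl j)), rfl⟩
      · rfl
  · rw [Circuit.angle_parallel]
    simp only [restrict, (h _ _).2, Finset.sum_const_zero]

/-! ### Boolean functions of boundedly many bits -/

section BooleanFunctions

variable {X Y : Type} [DecidableEq X]

/-- The assignment `u` with the bits outside `s` set to `false`. -/
def mask (s : List X) (u : X → Bool) (i : X) : Bool := decide (i ∈ s) && u i

theorem apply_mask_cons {s : List X} {i : X} (hi : i ∉ s) (f : (X → Bool) → Bool)
    (u : X → Bool) : f (mask (i :: s) u)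
      = xor (f (mask s u)) (u i && xor (f (mask s u)) (f (update (mask s u) i true))) := by
  have mask_cons : mask (i :: s) u = update (mask s u) i (u i) := by
    funext j
    by_cases hj : j = i
    · subst hj
      simp [mask]
    · simp [mask, hj]
  have update_false : update (mask s u) i false = mask s u := by
    rw [update_eq_self_iff]
    simp [mask, hi]
  cases h : u i <;> simp [mask_cons, h, update_false]

/-- Gates that add `f (mask s x)` to the wire `t`, on wires holding the bits `x`, the targets `Y`
and one ancilla per bit of `x`. They follow the expansion `apply_mask_cons`, the second summand of
which needs an ancilla to hold the coefficient of `x i`. -/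
def xorGates : List X → Y ⊕ X → ((X → Bool) → Bool) → List (Gate (X ⊕ Y ⊕ X))
  | [], t, f => if f fun _ => false then [.not (.inr t)] else []
  | i :: s, t, f =>
    let coeff := xorGates s (.inr i) fun u => xor (f u) (f (update u i true))
    xorGates s t f ++ (coeff ++ .toffoli (.inl i) (.inr (.inr i)) (.inr t) :: coeff)

theorem length_xorGates_lt (s : List X) (t : Y ⊕ X) (f : (X → Bool) → Bool) :
    (xorGates s t f).length < 2 * 3 ^ s.length := by
  induction s generalizing t f with
  | nil => by_cases h : f fun _ => false <;> simp [xorGates, h]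
  | cons i s ih =>
    have h₀ := ih t f
    have h₁ := ih (.inr i) fun u => xor (f u) (f (update u i true))
    simp only [xorGates, List.length_append, List.length_cons, pow_succ]
    omega

theorem nodup_wires_of_mem_xorGates {s : List X} (hs : s.Nodup) {t : Y ⊕ X}
    (ht : ∀ i ∈ s, t ≠ .inr i) (f : (X → Bool) → Bool) :
    ∀ g ∈ xorGates s t f, g.wires.Nodup := by
  induction s generalizing t f with
  | nil => by_cases h : f fun _ => false <;> simp [xorGates, h, Gate.wires]
  | cons i s ih =>
    rw [List.nodup_cons] at hs
    rw [List.forall_mem_cons] at ht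
    have coeff_nodup := ih hs.2 (t := .inr i) (by aesop) fun u => xor (f u) (f (update u i true))
    simp only [xorGates, List.forall_mem_append, List.forall_mem_cons]
    refine ⟨ih hs.2 ht.2 f, coeff_nodup, ?_, coeff_nodup⟩
    simpa [Gate.wires] using ht.1.symm

section

variable [DecidableEq Y]

theorem totalAngle_xorGates (s : List X) (t : Y ⊕ X) (f : (X → Bool) → Bool)
    (b : X ⊕ Y ⊕ X → Bool) : totalAngle (xorGates s t f) b = 0 := by
  induction s generalizing t f b with
  | nil => by_cases h : f fun _ => false <;> simp [xorGates, h, Gate.angle]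
  | cons i s ih => simp [xorGates, ih, Gate.angle]

theorem runGates_xorGates {s : List X} (hs : s.Nodup) {t : Y ⊕ X} (ht : ∀ i ∈ s, t ≠ .inr i)
    (f : (X → Bool) → Bool) {b : X ⊕ Y ⊕ X → Bool} (hb : ∀ i ∈ s, b (.inr (.inr i)) = false) :
    runGates (xorGates s t f) b
      = update b (.inr t) (xor (b (.inr t)) (f (mask s fun i => b (.inl i)))) := by
  induction s generalizing t f b with
  | nil =>
    have mask_nil : mask [] (fun i => b (.inl i)) = fun _ => false := rfl
    rw [mask_nil]
    by_cases h : f fun _ => false <;> simp [xorGates, h, Gate.flip]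
  | cons i s ih =>
    rw [List.nodup_cons] at hs
    rw [List.forall_mem_cons] at ht hb
    have hne : ∀ j ∈ s, j ≠ i := fun j hj h => hs.1 (h ▸ hj)
    have ht' : ∀ j ∈ s, .inr j ≠ t := fun j hj => (ht.2 j hj).symm
    have run_coeff {b' : X ⊕ Y ⊕ X → Bool} (hb' : ∀ j ∈ s, b' (.inr (.inr j)) = false) :=
      ih hs.2 (t := .inr i) (fun j hj h => hne j hj (Sum.inr.inj h).symm)
        (fun u => xor (f u) (f (update u i true))) hb'
    have run_coeff_first := run_coeff
      (b' := update b (.inr t) (xor (b (.inr t)) (f (mask s fun i => b (.inl i)))))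
      (by simpa +contextual [ht'] using hb.2)
    simp only [xorGates, runGates_append, runGates_cons, ih hs.2 ht.2 f hb.2, run_coeff_first]
    rw [run_coeff (by simpa +contextual [Gate.flip, ht', hne] using hb.2),
      apply_mask_cons hs.1 f]
    funext w
    rcases eq_or_ne w (.inr t) with rfl | hwt
    · simp [Gate.flip, ht.1, ht.1.symm, hb.1]
    rcases eq_or_ne w (.inr (.inr i)) with rfl | hwi
    · simp [Gate.flip, ht.1, ht.1.symm, hb.1]
    · simp [Gate.flip, hwt, hwi]

theorem runGates_flatMap_xorGates {s : List X} (hs : s.Nodup) {l : List Y}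
    (hl : l.Nodup) (f : (X → Bool) → Y → Bool) (x : X → Bool) (y : Y → Bool) :
    runGates (l.flatMap fun j => xorGates s (.inl j) fun u => f u j)
        (Sum.elim x (Sum.elim y fun _ => false))
      = Sum.elim x
          (Sum.elim (fun j => xor (y j) (decide (j ∈ l) && f (mask s x) j)) fun _ => false) := by
  induction l generalizing y with
  | nil => simp
  | cons j l ih =>
    rw [List.nodup_cons] at hl
    rw [List.flatMap_cons, runGates_append, runGates_xorGates hs (by simp) _ (by simp)]
    simp only [Sum.elim_inl, Sum.elim_inr, Sum.update_elim_inr, Sum.update_elim_inl, ih hl.2]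
    congr 2
    funext j'
    rcases eq_or_ne j' j with rfl | hj
    · simp [hl.1]
    · simp [hj]

theorem totalAngle_flatMap_xorGates (s : List X) (l : List Y)
    (f : (X → Bool) → Y → Bool) (b : X ⊕ Y ⊕ X → Bool) :
    totalAngle (l.flatMap fun j => xorGates s (.inl j) fun u => f u j) b = 0 := by
  induction l generalizing b with
  | nil => rfl
  | cons j l ih => simp [ih, totalAngle_xorGates]

end

variable [Fintype X] [Fintype Y]

/-- The circuit that adds the bits `f x y` to the target wires `y`, one after the other. -/
noncomputable def xorCircuit (f : (X → Bool) → Y → Bool) : Circuit (X ⊕ Y ⊕ X) :=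
  .ofGates (Finset.univ.toList.flatMap fun y =>
      xorGates Finset.univ.toList (.inl y) fun u => f u y) <| by
    simp only [List.mem_flatMap]
    rintro g ⟨y, -, hg⟩
    exact nodup_wires_of_mem_xorGates (Finset.nodup_toList _) (by simp) _ g hg

theorem depth_xorCircuit_le (f : (X → Bool) → Y → Bool) :
    (xorCircuit f).depth ≤ Fintype.card Y * (2 * 3 ^ Fintype.card X) := by
  rw [xorCircuit, Circuit.depth_ofGates, List.length_flatMap, Finset.sum_map_toList]
  refine Finset.sum_le_card_nsmul _ _ _ fun y _ => ?_
  simpa using (length_xorGates_lt Finset.univ.toList (.inl y) fun u => f u y).le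

theorem xorCircuit_computesInto [DecidableEq Y] (f : (X → Bool) → Y → Bool) :
    (xorCircuit f).ComputesInto f := by
  intro x y
  have mask_univ : mask Finset.univ.toList x = x := by
    funext i
    simp [mask]
  constructor
  · simp [xorCircuit, runGates_flatMap_xorGates (Finset.nodup_toList _) (Finset.nodup_toList _),
      mask_univ]
  · simp [xorCircuit, totalAngle_flatMap_xorGates]

/-- The phase `θ` is applied one value `v` at a time, controlled by the indicator of `v`. -/
theorem exists_realizable (X : Type) [DecidableEq X] [Finite X] :
    ∃ d a, ∀ θ : (X → Bool) → ℝ, Realizable θ d a := by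
  have := Fintype.ofFinite X
  let indicators (x v : X → Bool) : Bool := decide (x = v)
  have indicator_phase (θ : (X → Bool) → ℝ) (v : X → Bool) :
      Realizable (fun y : (X → Bool) → Bool => if y v then θ v else 0) 1 0 := by
    have nodup : ∀ g ∈ [Gate.phase (W := (X → Bool) ⊕ Fin 0) (θ v) (.inl v)], g.wires.Nodup := by
      simp [Gate.wires]
    exact ⟨.ofGates _ nodup, by simp, fun y => ⟨by simp [Gate.flip], add_zero _⟩⟩
  have phase_realizable (θ : (X → Bool) → ℝ) :=
    Realizable.comp (xorCircuit_computesInto indicators) (Realizable.sum (indicator_phase θ))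
  exact ⟨_, _, fun θ => by simpa [indicators] using phase_realizable θ⟩

end BooleanFunctions

/-! ### Evaluation and interpolation -/

section Interpolation

variable {𝕜 ι F : Type*} [Field 𝕜] [Fintype ι] [Fintype F]

theorem exists_interpolation_weights {v : ι → 𝕜} (hv : Injective v) (y : 𝕜) :
    ∃ c : ι → 𝕜, ∀ P : Polynomial 𝕜, P.degree < Fintype.card ι →
      ∑ i, c i * P.eval (v i) = P.eval y := by
  classical
  refine ⟨fun i => (Lagrange.basis Finset.univ v i).eval y, fun P hP => ?_⟩
  have interpolate : P = Lagrange.interpolate Finset.univ v fun i => P.eval (v i) :=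
    Lagrange.eq_interpolate hv.injOn (by simpa using hP)
  conv_rhs => rw [interpolate, Lagrange.interpolate_apply, Polynomial.eval_finsetSum]
  simp [mul_comm]

theorem degree_prod_sum_lt [Nonempty F] {K : ℕ} (hK : 0 < K) (x : F → Fin K → 𝕜) :
    (∏ f, ∑ k, Polynomial.C (x f k) * Polynomial.X ^ (k : ℕ)).degree
      < ((Fintype.card F * K : ℕ) : WithBot ℕ) := by
  have natDegree_le : (∏ f, ∑ k, Polynomial.C (x f k) * Polynomial.X ^ (k : ℕ)).natDegree
      ≤ Fintype.card F * (K - 1) := by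
    refine (Polynomial.natDegree_prod_le _ _).trans ?_
    rw [← smul_eq_mul]
    refine Finset.sum_le_card_nsmul _ _ _ fun f _ => ?_
    refine Polynomial.natDegree_sum_le_of_forall_le _ _ fun k _ => ?_
    exact (Polynomial.natDegree_C_mul_X_pow_le _ _).trans (Nat.le_sub_one_of_lt k.isLt)
  have card_lt : Fintype.card F * (K - 1) < Fintype.card F * K :=
    Nat.mul_lt_mul_of_pos_left (Nat.sub_one_lt hK.ne') Fintype.card_pos
  exact Polynomial.degree_le_natDegree.trans_lt (by exact_mod_cast natDegree_le.trans_lt card_lt)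

theorem exists_product_weights [Nonempty F] {K : ℕ} (hK : 0 < K)
    (hι : Fintype.card F * K ≤ Fintype.card ι) {v : ι → 𝕜} (hv : Injective v) (y : 𝕜) :
    ∃ c : ι → 𝕜, ∀ x : F → Fin K → 𝕜,
      ∑ i, c i * ∏ f, ∑ k, x f k * v i ^ (k : ℕ) = ∏ f, ∑ k, x f k * y ^ (k : ℕ) := by
  obtain ⟨c, hc⟩ := exists_interpolation_weights hv y
  refine ⟨c, fun x => ?_⟩
  have degree_lt := (degree_prod_sum_lt hK x).trans_le (Nat.cast_le.mpr hι)
  simpa [Polynomial.eval_prod, Polynomial.eval_finsetSum] using hc _ degree_lt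

end Interpolation

/-! ### Redundant binary representations -/

section BitSum

variable {X Y : Type*} [Fintype X] [Fintype Y]

/-- The number represented by the bits `u`, the bit `x` having weight `w x`. -/
def bitSum (w : X → ℕ) (u : X → Bool) : ℕ := ∑ x, (u x).toNat * w x

theorem bitSum_le (w : X → ℕ) (u : X → Bool) : bitSum w u ≤ ∑ x, w x :=
  Finset.sum_le_sum fun x _ => mul_le_of_le_one_left (Nat.zero_le _) (Bool.toNat_le (u x))

theorem bitSum_extend (w : Y → ℕ) (ι : X ↪ Y) (u : X → Bool) :
    bitSum w (extend ι u fun _ => false) = bitSum (fun x => w (ι x)) u := by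
  classical
  refine (Finset.sum_of_injOn ι ι.injective.injOn (by simp) (fun y _ hy => ?_) fun x _ => ?_).symm
  · rw [extend_apply' _ _ _ (by simpa using hy), Bool.toNat_false, zero_mul]
  · rw [ι.injective.extend_apply]

theorem bitSum_curry {F : Type*} [Fintype F] [DecidableEq F] (w : X → ℕ) (u : F × X → Bool)
    (f : F) : bitSum w (fun x => u (f, x)) = bitSum (fun y => if y.1 = f then w y.2 else 0) u := by
  simp [bitSum, Fintype.sum_prod_type_right]

theorem bitSum_testBit (v b : ℕ) :
    bitSum (fun i : Fin b => 2 ^ (i : ℕ)) (fun i => v.testBit i) = v % 2 ^ b := by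
  induction b with
  | zero => simp [bitSum, Nat.mod_one]
  | succ b ih =>
    rw [Nat.mod_pow_succ, ← ih, bitSum, Fin.sum_univ_castSucc, Fin.val_last,
      Nat.testBit_eq_decide_div_mod_eq]
    rcases Nat.mod_two_eq_zero_or_one (v / 2 ^ b) with h | h <;> simp [bitSum, h]

end BitSum

section Digits

variable {m b K L : ℕ}

/-- The bits of a number with `m` digits in base `2 ^ b`. The representation is redundant: every
digit is a sum of two numbers of `b` bits, so that a carry can be stored without propagating it. -/
abbrev Digits (m b : ℕ) : Type := Fin m × Fin 2 × Fin b

/-- The number represented by redundant digits. -/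
def value (u : Digits m b → Bool) : ℕ := bitSum (fun y => 2 ^ (b * y.1 + y.2.2 : ℕ)) u

/-- The linear combination, with coefficients `1, w, w², …`, of the `K` digits in `z`. -/
def combine (w : ℕ) (z : Digits K b → Bool) : ℕ :=
  bitSum (fun y => w ^ (y.1 : ℕ) * 2 ^ (y.2.2 : ℕ)) z

theorem combine_lt {w : ℕ} (hw : 2 * ∑ k : Fin K, w ^ (k : ℕ) ≤ 2 ^ b) (z : Digits K b → Bool) :
    combine w z < 2 ^ (2 * b) := by
  have geom_sum : ∑ i : Fin b, 2 ^ (i : ℕ) + 1 = 2 ^ b := by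
    rw [Fin.sum_univ_eq_sum_range fun i => 2 ^ i]
    simpa using geom_sum_mul_add (1 : ℕ) b
  calc combine w z ≤ ∑ y : Digits K b, w ^ (y.1 : ℕ) * 2 ^ (y.2.2 : ℕ) := bitSum_le _ _
    _ = 2 * (∑ k : Fin K, w ^ (k : ℕ)) * ∑ i : Fin b, 2 ^ (i : ℕ) := by
      simp only [Fintype.sum_prod_type, Fin.sum_univ_two, ← Finset.mul_sum, ← Finset.sum_mul]
      ring
    _ ≤ 2 ^ b * ∑ i : Fin b, 2 ^ (i : ℕ) := Nat.mul_le_mul_right _ hw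
    _ < 2 ^ b * 2 ^ b := Nat.mul_lt_mul_of_pos_left (by omega) (by positivity)
    _ = 2 ^ (2 * b) := by ring

/-- The position to which bit `i + b * h` of a number standing in the place `t` belongs: bit `i`
of the place `t + h`. -/
def carryPosition : Digits L b ↪ Digits (L + 1) b where
  toFun y := (⟨y.1 + y.2.1, by omega⟩, y.2)
  inj' y y' h := by
    simp only [Prod.mk.injEq, Fin.mk.injEq] at h
    exact Prod.ext (Fin.ext (by simpa [h.2] using h.1)) h.2

/-- The digits in place `t` of the `K` blocks of `L` consecutive digits of `u`. -/
def column (u : Digits (K * L) b → Bool) (t : Fin L) (z : Digits K b) : Bool :=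
  u (finProdFinEquiv (z.1, t), z.2)

/-- The block `k` of `L` consecutive digits of `u`. -/
def block (u : Digits (K * L) b → Bool) (k : Fin K) (y : Digits L b) : Bool :=
  u (finProdFinEquiv (k, y.1), y.2)

/-- Redundant digits of the value at `w` of the polynomial whose coefficients are the numbers in the
blocks of `u`. Each of the `L` columns is combined separately. -/
noncomputable def evalBits (w : ℕ) (u : Digits (K * L) b → Bool) : Digits (L + 1) b → Bool :=
  extend carryPosition (fun y => (combine w (column u y.1)).testBit (y.2.2 + b * y.2.1))
    fun _ => false

theorem value_eq_sum_block (u : Digits (K * L) b → Bool) :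
    value u = ∑ k, value (block u k) * (2 ^ (b * L)) ^ (k : ℕ) := by
  simp only [value, bitSum, block, Finset.sum_mul]
  rw [← (finProdFinEquiv.prodCongr (Equiv.refl (Fin 2 × Fin b))).sum_comp]
  rw [Fintype.sum_prod_type, Fintype.sum_prod_type]
  refine Finset.sum_congr rfl fun k _ => ?_
  rw [Fintype.sum_prod_type]
  refine Finset.sum_congr rfl fun t _ => Finset.sum_congr rfl fun y _ => ?_
  rw [Equiv.prodCongr_apply, Prod.map_apply, Equiv.refl_apply, finProdFinEquiv_apply_val]
  ring

theorem value_evalBits {w : ℕ} (hw : 2 * ∑ k : Fin K, w ^ (k : ℕ) ≤ 2 ^ b)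
    (u : Digits (K * L) b → Bool) :
    value (evalBits w u) = ∑ k, value (block u k) * w ^ (k : ℕ) := by
  have sum_bits (t : Fin L) : ∑ y : Fin 2 × Fin b,
        ((combine w (column u t)).testBit (y.2 + b * y.1)).toNat * 2 ^ (y.2 + b * y.1 : ℕ)
      = combine w (column u t) := by
    have sum_eq := bitSum_testBit (combine w (column u t)) (2 * b)
    rw [Nat.mod_eq_of_lt (combine_lt hw _), bitSum, ← finProdFinEquiv.sum_comp] at sum_eq
    simpa only [finProdFinEquiv_apply_val] using sum_eq
  calc value (evalBits w u)
      = ∑ t : Fin L, 2 ^ (b * t : ℕ) * combine w (column u t) := by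
        rw [value, evalBits, bitSum_extend, bitSum, Fintype.sum_prod_type]
        refine Finset.sum_congr rfl fun t _ => ?_
        rw [← sum_bits, Finset.mul_sum]
        refine Finset.sum_congr rfl fun y _ => ?_
        change _ * 2 ^ (b * (t + y.1) + y.2 : ℕ) = _
        ring
    _ = ∑ k, value (block u k) * w ^ (k : ℕ) := by
        simp only [value, combine, bitSum, block, column, Fintype.sum_prod_type (α₁ := Fin K),
          Fintype.sum_prod_type (α₁ := Fin L), Finset.sum_mul, Finset.mul_sum]
        rw [Finset.sum_comm]
        refine Finset.sum_congr rfl fun k _ => Finset.sum_congr rfl fun t _ =>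
          Finset.sum_congr rfl fun y _ => ?_
        ring

/-- The representations are the coefficients of a polynomial in `2 ^ (b * L)`, so products can be
computed by evaluation and interpolation. -/
theorem exists_value_weights {F ι : Type*} [Fintype F] [Nonempty F] [Fintype ι] (hK : 0 < K)
    (hι : Fintype.card F * K ≤ Fintype.card ι) {v : ι → ℕ} (hv : Injective v)
    (hb : ∀ i, 2 * ∑ k : Fin K, v i ^ (k : ℕ) ≤ 2 ^ b) :
    ∃ c : ι → ℝ, ∀ u : F → Digits (K * L) b → Bool,
      ∑ i, c i * ∏ f, (value (evalBits (v i) (u f)) : ℝ) = ∏ f, (value (u f) : ℝ) := by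
  obtain ⟨c, hc⟩ := exists_product_weights (F := F) (v := fun i => (v i : ℝ)) hK hι
    (Nat.cast_injective.comp hv) (2 ^ (b * L))
  refine ⟨c, fun u => ?_⟩
  simpa [value_evalBits (hb _), value_eq_sum_block] using hc fun f k => (value (block (u f) k) : ℝ)

end Digits

/-! ### The recursion -/

section Recursion

variable {F : Type} [Fintype F] [DecidableEq F] {K L b ρ : ℕ}

/-- Phases proportional to a product of numbers, one for each element of `F`, that are given by `m`
redundant digits each can be applied in depth `d` with `a` ancillas. -/
def ProductRealizable (F : Type) [Fintype F] [DecidableEq F] (m b d a : ℕ) : Prop :=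
  ∀ φ : ℝ, Realizable
    (fun u : F × Digits m b → Bool => φ * ∏ f, (value fun x => u (f, x) : ℝ)) d a

/-- The evaluation points `w s` and the columns are treated in parallel, so the depth does not
depend on the number `L` of columns. -/
theorem exists_evalCircuit (F : Type) [Finite F] [DecidableEq F] (L : ℕ) (w : Fin ρ → ℕ) :
    ∃ E : Circuit ((F × Digits (K * L) b) ⊕ (Fin ρ × F × Digits (L + 1) b) ⊕
        (F × Fin L) × Digits K b),
      E.depth ≤ Fintype.card (Fin ρ × Fin 2 × Fin b) * (2 * 3 ^ Fintype.card (Digits K b)) ∧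
      E.ComputesInto fun u p => evalBits (w p.1) (fun x => u (p.2.1, x)) p.2.2 := by
  let bits (z : Digits K b → Bool) (y : Fin ρ × Fin 2 × Fin b) : Bool :=
    (combine (w y.1) z).testBit (y.2.2 + b * y.2.1)
  let source : (F × Fin L) × Digits K b ↪ F × Digits (K * L) b :=
    ⟨fun p => (p.1.1, finProdFinEquiv (p.2.1, p.1.2), p.2.2), fun p p' h => by
      simp only [Prod.mk.injEq, EmbeddingLike.apply_eq_iff_eq] at h
      grind⟩
  let target : (F × Fin L) × Fin ρ × Fin 2 × Fin b ↪ Fin ρ × F × Digits (L + 1) b :=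
    ⟨fun p => (p.2.1, p.1.1, carryPosition (p.1.2, p.2.2)), fun p p' h => by
      simp only [Prod.mk.injEq, EmbeddingLike.apply_eq_iff_eq] at h
      grind⟩
  obtain ⟨E, hE, computes⟩ := (xorCircuit_computesInto bits).parallel source target
  refine ⟨E, hE.trans (depth_xorCircuit_le bits), ?_⟩
  convert computes using 2 with u
  refine (extend_eq_of_forall target.injective ?_ ?_).symm
  · rintro ⟨⟨f, t⟩, s, y⟩
    exact carryPosition.injective.extend_apply _ _ (t, y)
  · rintro ⟨s, f, x⟩ hx
    refine extend_apply' _ _ _ ?_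
    rintro ⟨⟨t, y⟩, rfl⟩
    exact hx ⟨((f, t), s, y), rfl⟩

/-- Of the `r * ρ` evaluation points, `ρ` are treated at a time. -/
theorem ProductRealizable.exists_step [Nonempty F] {r : ℕ} (hK : 0 < K)
    (hr : Fintype.card F * K ≤ r * ρ)
    (hb : ∀ w < r * ρ, 2 * ∑ k : Fin K, w ^ (k : ℕ) ≤ 2 ^ b) :
    ∃ N A, ∀ L d a, ProductRealizable F (L + 1) b d a →
      ProductRealizable F (K * L) b (r * (N + d + N)) (ρ * a + A * (L + 1)) := by
  let N := Fintype.card (Fin ρ × Fin 2 × Fin b) * (2 * 3 ^ Fintype.card (Digits K b))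
  refine ⟨N, Fintype.card F * (2 * b) * (ρ + K), fun L d a h φ => ?_⟩
  let node (i : Fin r × Fin ρ) : ℕ := finProdFinEquiv i
  obtain ⟨c, hc⟩ := exists_value_weights (F := F) (L := L) (v := node) hK (by simpa using hr)
    (Fin.val_injective.comp finProdFinEquiv.injective) fun i => hb _ (Fin.is_lt _)
  have round (t : Fin r) : Realizable
      (fun u : F × Digits (K * L) b → Bool =>
        ∑ s, φ * c (t, s) * ∏ f, (value (evalBits (node (t, s)) fun x => u (f, x)) : ℝ))
      (N + d + N) (ρ * a + Fintype.card F * (2 * b) * (ρ + K) * (L + 1)) := by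
    obtain ⟨E, hE, computes⟩ := exists_evalCircuit (K := K) (b := b) F L fun s => node (t, s)
    refine (Realizable.comp computes
      (Realizable.parallel fun s => h (φ * c (t, s)))).mono (by gcongr) ?_
    simp only [Fintype.card_prod, Fintype.card_fin]
    have source_le := Nat.mul_le_mul_right (Fintype.card F * (K * (2 * b))) (Nat.le_succ L)
    linarith
  have sum_rounds (u : F × Digits (K * L) b → Bool) :
      ∑ t, ∑ s, φ * c (t, s) * ∏ f, (value (evalBits (node (t, s)) fun x => u (f, x)) : ℝ)
        = φ * ∏ f, (value fun x => u (f, x) : ℝ) := by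
    simp only [← hc fun f x => u (f, x), Fintype.sum_prod_type, Finset.mul_sum, mul_assoc]
  simpa only [sum_rounds, Fintype.card_fin] using Realizable.sum round

/-- The slack in the invariants `K ^ j + 2 ≤ m` and `d + 4 * N ≤ C * r ^ j` absorbs the additional
digit and the evaluations. -/
theorem exists_bounds_of_step {P : ℕ → ℕ → ℕ → Prop} {K r ρ N A d₀ a₀ : ℕ} (hK : 2 ≤ K)
    (hr : 2 ≤ r) (hρ : ρ < K) (initial : P 3 d₀ a₀)
    (step : ∀ L d a, P (L + 1) d a → P (K * L) (r * (N + d + N)) (ρ * a + A * (L + 1))) :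
    ∃ C, ∀ j, ∃ m d a, P m d a ∧ K ^ j ≤ m ∧ m ≤ 3 * K ^ j ∧ d ≤ C * r ^ j ∧ a ≤ C * K ^ j := by
  let C := d₀ + 4 * N + a₀ + 3 * A
  have invariant (j : ℕ) : ∃ m d a, P m d a ∧ K ^ j + 2 ≤ m ∧ m ≤ 3 * K ^ j ∧
      d + 4 * N ≤ C * r ^ j ∧ a ≤ C * K ^ j := by
    induction j with
    | zero =>
      simp only [C, pow_zero]
      exact ⟨3, d₀, a₀, initial, by omega, by omega, by omega, by omega⟩
    | succ j ih =>
      obtain ⟨m, d, a, hP, le_m, m_le, d_le, a_le⟩ := ih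
      obtain ⟨L, rfl⟩ : ∃ L, m = L + 1 := ⟨m - 1, by omega⟩
      have three_mul_A_le : 3 * A ≤ C := by omega
      refine ⟨_, _, _, step L d a hP, ?_, ?_, ?_, ?_⟩
      · calc K ^ (j + 1) + 2 ≤ K ^ (j + 1) + K := by omega
          _ = K * (K ^ j + 1) := by ring
          _ ≤ K * L := Nat.mul_le_mul_left K (by omega)
      · calc K * L ≤ K * (3 * K ^ j) := Nat.mul_le_mul_left K (by omega)
          _ = 3 * K ^ (j + 1) := by ring
      · calc r * (N + d + N) + 4 * N = r * (d + 2 * N) + 2 * (2 * N) := by ring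
          _ ≤ r * (d + 2 * N) + r * (2 * N) := by gcongr
          _ = r * (d + 4 * N) := by ring
          _ ≤ r * (C * r ^ j) := by gcongr
          _ = C * r ^ (j + 1) := by ring
      · calc ρ * a + A * (L + 1) ≤ ρ * (C * K ^ j) + A * (3 * K ^ j) := by gcongr
          _ = (ρ * C + 3 * A) * K ^ j := by ring
          _ ≤ (ρ * C + C) * K ^ j := by gcongr
          _ = (ρ + 1) * (C * K ^ j) := by ring
          _ ≤ K * (C * K ^ j) := Nat.mul_le_mul_right _ hρ
          _ = C * K ^ (j + 1) := by ring
  refine ⟨C, fun j => ?_⟩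
  obtain ⟨m, d, a, hP, le_m, m_le, d_le, a_le⟩ := invariant j
  exact ⟨m, d, a, hP, by omega, m_le, by omega, a_le⟩

theorem exists_productRealizable_pow [Nonempty F] {r : ℕ} (hr2 : 2 ≤ r) (hρ : ρ < K)
    (hr : Fintype.card F * K ≤ r * ρ) :
    ∃ b C, 0 < b ∧ ∀ j, ∃ m d a, ProductRealizable F m b d a ∧
      K ^ j ≤ m ∧ m ≤ 3 * K ^ j ∧ d ≤ C * r ^ j ∧ a ≤ C * K ^ j := by
  have hK : 0 < K := hρ.pos
  have nodes_pos : 0 < r * ρ := (Nat.mul_pos Fintype.card_pos hK).trans_le hr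
  have ρ_pos : 0 < ρ := pos_of_mul_pos_right nodes_pos (Nat.zero_le r)
  let b := 2 * (K * (r * ρ) ^ K)
  have geom_sum_le (w : ℕ) (hw : w < r * ρ) : 2 * ∑ k : Fin K, w ^ (k : ℕ) ≤ 2 ^ b := by
    refine le_trans (Nat.mul_le_mul_left 2 ?_) Nat.lt_two_pow_self.le
    refine (Finset.sum_le_card_nsmul _ _ ((r * ρ) ^ K) fun k _ => ?_).trans (by simp)
    exact (Nat.pow_le_pow_left hw.le _).trans (Nat.pow_le_pow_right nodes_pos k.isLt.le)
  obtain ⟨d₀, a₀, initial⟩ := exists_realizable (F × Digits 3 b)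
  obtain ⟨N, A, step⟩ := ProductRealizable.exists_step hK hr geom_sum_le
  obtain ⟨C, hC⟩ := exists_bounds_of_step (P := (ProductRealizable F · b)) (by omega) hr2 hρ
    (fun φ => initial _) step
  exact ⟨b, C, by positivity, hC⟩

end Recursion

/-! ### Registers -/

section Registers

variable {F D : Type} [Fintype F] [DecidableEq F] [Fintype D] {n : ℕ}

/-- The number held by the register `f` when the qubits `D` are distributed over registers indexed
by `F`, the qubit `x` being bit `(pos x).2` of the register `(pos x).1`. -/
def registerSum (pos : D → F × Fin n) (u : D → Bool) (f : F) : ℕ :=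
  bitSum (fun x => if (pos x).1 = f then 2 ^ ((pos x).2 : ℕ) else 0) u

theorem ProductRealizable.registers [DecidableEq D] {m b d a : ℕ} (h : ProductRealizable F m b d a)
    (hb : 0 < b) (hn : n ≤ m) (pos : D ↪ F × Fin n) (φ : ℝ) :
    Realizable (fun u => φ * ∏ f, (registerSum pos u f : ℝ)) d
      (Fintype.card F * (m * (2 * b)) + a) := by
  let digit (i : Fin n) : Digits m b :=
    (⟨i / b, (Nat.div_le_self _ _).trans_lt (i.isLt.trans_le hn)⟩, 0, ⟨i % b, Nat.mod_lt _ hb⟩)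
  have digit_injective : Injective digit := fun i i' h => by
    simp only [digit, Prod.mk.injEq, Fin.mk.injEq, true_and] at h
    rw [Fin.ext_iff, ← Nat.div_add_mod i b, ← Nat.div_add_mod i' b, h.1, h.2]
  let wire : D ↪ F × Digits m b :=
    pos.trans ((Embedding.refl F).prodMap ⟨digit, digit_injective⟩)
  have value_extend (u : D → Bool) (f : F) :
      value (fun x => extend wire u (fun _ => false) (f, x)) = registerSum pos u f := by
    rw [value, bitSum_curry, bitSum_extend, registerSum]
    congr 1
    funext x
    simp [wire, digit, Nat.div_add_mod]
  simpa [value_extend] using (h φ).extend wire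

theorem pow_clog_le_mul {K : ℕ} (hK : 1 < K) (hn : 0 < n) : K ^ Nat.clog K n ≤ K * n := by
  rcases (Nat.succ_le_of_lt hn).eq_or_lt with rfl | hn
  · simpa using hK.le
  · rw [← Nat.sub_add_cancel (Nat.clog_pos hK hn), pow_succ']
    exact Nat.mul_le_mul_left K (Nat.pow_pred_clog_lt_self hK hn).le

theorem pow_clog_le_rpow_mul_rpow {K : ℕ} {q ε : ℝ} (hq : 0 ≤ q) (hε : 0 ≤ ε) (hK : 1 < K)
    (hqK : q ≤ (K : ℝ) ^ ε) (hn : 0 < n) :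
    q ^ Nat.clog K n ≤ (K : ℝ) ^ ε * (n : ℝ) ^ ε :=
  calc q ^ Nat.clog K n ≤ ((K : ℝ) ^ ε) ^ Nat.clog K n := by gcongr
    _ = ((K ^ Nat.clog K n : ℕ) : ℝ) ^ ε := by
      rw [Nat.cast_pow, Real.rpow_pow_comm (Nat.cast_nonneg K)]
    _ ≤ ((K * n : ℕ) : ℝ) ^ ε := by
      gcongr
      exact pow_clog_le_mul hK hn
    _ = (K : ℝ) ^ ε * (n : ℝ) ^ ε := by
      rw [Nat.cast_mul, Real.mul_rpow (Nat.cast_nonneg K) (Nat.cast_nonneg n)]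

/-- However large `K` is, `2 * card F` rounds of `K - 1` products suffice, so that the exponent
`log_K (2 * card F)` of the depth becomes as small as desired. -/
theorem exists_circuit_registers (F : Type) [Fintype F] [DecidableEq F] [Nonempty F] {ε : ℝ}
    (hε : 0 < ε) :
    ∃ C : ℝ, ∀ (n : ℕ) (D : Type) [Fintype D] [DecidableEq D] (pos : D ↪ F × Fin n) (φ : ℝ),
      ∃ (a : ℕ) (c : Circuit (D ⊕ Fin a)),
        c.AppliesPhase (fun u => φ * ∏ f, (registerSum pos u f : ℝ)) ∧
        (c.depth : ℝ) ≤ C * (n : ℝ) ^ ε ∧ (a : ℝ) ≤ C * n := by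
  obtain ⟨K, rounds_le, one_lt_K⟩ : ∃ K : ℕ, (2 * Fintype.card F : ℕ) ≤ (K : ℝ) ^ ε ∧ 1 < K :=
    ((((tendsto_rpow_atTop hε).comp tendsto_natCast_atTop_atTop).eventually_ge_atTop _).and
      (Filter.eventually_gt_atTop 1)).exists
  have card_pos : 0 < Fintype.card F := Fintype.card_pos
  obtain ⟨b, C, hb, hC⟩ := exists_productRealizable_pow (F := F) (K := K) (ρ := K - 1)
    (r := 2 * Fintype.card F) (by omega) (by omega) <| by
      rw [mul_comm 2, mul_assoc]
      exact Nat.mul_le_mul_left _ (by omega)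
  let Ca := (Fintype.card F * (6 * b) + C) * K
  refine ⟨max (C * (K : ℝ) ^ ε) Ca, fun n D _ _ pos φ => ?_⟩
  rcases Nat.eq_zero_or_pos n with rfl | hn
  · have : IsEmpty D := ⟨fun x => (pos x).2.elim0⟩
    refine ⟨0, .ofGates [] (by simp), fun u => ?_, ?_, by simp⟩
    · simp [registerSum, bitSum]
    · rw [Circuit.depth_ofGates, List.length_nil, Nat.cast_zero]
      positivity
  obtain ⟨m, d, a, h, le_m, m_le, d_le, a_le⟩ := hC (Nat.clog K n)
  obtain ⟨c, depth_le, hc⟩ := h.registers hb ((Nat.le_pow_clog one_lt_K n).trans le_m) pos φ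
  have ancillas_le : Fintype.card F * (m * (2 * b)) + a ≤ Ca * n :=
    calc Fintype.card F * (m * (2 * b)) + a
        ≤ Fintype.card F * (3 * K ^ Nat.clog K n * (2 * b)) + C * K ^ Nat.clog K n := by gcongr
      _ = (Fintype.card F * (6 * b) + C) * K ^ Nat.clog K n := by ring
      _ ≤ (Fintype.card F * (6 * b) + C) * (K * n) :=
        Nat.mul_le_mul_left _ (pow_clog_le_mul one_lt_K hn)
      _ = Ca * n := (mul_assoc _ _ _).symm
  refine ⟨_, c, hc, ?_, ?_⟩
  · calc (c.depth : ℝ) ≤ C * ((2 * Fintype.card F : ℕ) : ℝ) ^ Nat.clog K n := by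
          exact_mod_cast depth_le.trans d_le
      _ ≤ C * ((K : ℝ) ^ ε * (n : ℝ) ^ ε) := by
          gcongr
          exact pow_clog_le_rpow_mul_rpow (Nat.cast_nonneg _) hε.le one_lt_K rounds_le hn
      _ = C * (K : ℝ) ^ ε * (n : ℝ) ^ ε := (mul_assoc _ _ _).symm
      _ ≤ _ := mul_le_mul_of_nonneg_right (le_max_left _ _) (by positivity)
  · exact (Nat.cast_le.mpr ancillas_le).trans <| (Nat.cast_mul Ca n).trans_le <|
      mul_le_mul_of_nonneg_right (le_max_right _ _) (Nat.cast_nonneg n)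

theorem exists_circuit_phaseProduct {ε : ℝ} (hε : 0 < ε) :
    ∃ C : ℝ, ∀ n p q : ℕ, p ≤ n → q ≤ n → ∀ φ : ℝ,
      ∃ (a : ℕ) (c : Circuit ((Fin p ⊕ Fin q) ⊕ Fin a)), c.Implements (phaseProduct p q φ) ∧
        (c.depth : ℝ) ≤ C * (n : ℝ) ^ ε ∧ (a : ℝ) ≤ C * n := by
  obtain ⟨C, hC⟩ := exists_circuit_registers (Fin 2) hε
  refine ⟨C, fun n p q hp hq φ => ?_⟩
  let pos : Fin p ⊕ Fin q → Fin 2 × Fin n :=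
    Sum.elim (fun i => (0, i.castLE hp)) fun i => (1, i.castLE hq)
  have pos_injective : Injective pos := by rintro (i | i) (i' | i') <;> simp [pos]
  obtain ⟨a, c, hc, bounds⟩ := hC n _ ⟨pos, pos_injective⟩ φ
  refine ⟨a, c, ?_, bounds⟩
  convert hc.implements using 1
  simp [phaseProduct, pos, registerSum, bitSum, regValue, Fin.prod_univ_two, mul_assoc]

theorem exists_circuit_phaseTripleProduct {ε : ℝ} (hε : 0 < ε) :
    ∃ C : ℝ, ∀ n p q r : ℕ, p ≤ n → q ≤ n → r ≤ n → ∀ φ : ℝ,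
      ∃ (a : ℕ) (c : Circuit ((Fin p ⊕ Fin q ⊕ Fin r) ⊕ Fin a)),
        c.Implements (phaseTripleProduct p q r φ) ∧
        (c.depth : ℝ) ≤ C * (n : ℝ) ^ ε ∧ (a : ℝ) ≤ C * n := by
  obtain ⟨C, hC⟩ := exists_circuit_registers (Fin 3) hε
  refine ⟨C, fun n p q r hp hq hr φ => ?_⟩
  let pos : Fin p ⊕ Fin q ⊕ Fin r → Fin 3 × Fin n :=
    Sum.elim (fun i => (0, i.castLE hp)) <|
      Sum.elim (fun i => (1, i.castLE hq)) fun i => (2, i.castLE hr)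
  have pos_injective : Injective pos := by rintro (i | i | i) (i' | i' | i') <;> simp [pos]
  obtain ⟨a, c, hc, bounds⟩ := hC n _ ⟨pos, pos_injective⟩ φ
  refine ⟨a, c, ?_, bounds⟩
  convert hc.implements using 1
  simp [phaseTripleProduct, pos, registerSum, bitSum, regValue, Fin.prod_univ_three, mul_assoc]

end Registers

end PhaseCircuit

theorem mainTheorem6_general {ε : ℝ} (hε : 0 < ε) :
    (∃ C : ℝ, ∀ n p q : ℕ, p ≤ n → q ≤ n → ∀ φ : ℝ,
      ∃ (a : ℕ) (c : PhaseCircuit.Circuit ((Fin p ⊕ Fin q) ⊕ Fin a)),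
        c.Implements (PhaseCircuit.phaseProduct p q φ) ∧
        (c.depth : ℝ) ≤ C * (n : ℝ) ^ ε ∧
        (a : ℝ) ≤ C * (n : ℝ)) ∧
    (∃ C : ℝ, ∀ n p q r : ℕ, p ≤ n → q ≤ n → r ≤ n → ∀ φ : ℝ,
      ∃ (a : ℕ) (c : PhaseCircuit.Circuit ((Fin p ⊕ Fin q ⊕ Fin r) ⊕ Fin a)),
        c.Implements (PhaseCircuit.phaseTripleProduct p q r φ) ∧
        (c.depth : ℝ) ≤ C * (n : ℝ) ^ ε ∧
        (a : ℝ) ≤ C * (n : ℝ)) :=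
  ⟨PhaseCircuit.exists_circuit_phaseProduct hε, PhaseCircuit.exists_circuit_phaseTripleProduct hε⟩

theorem mainTheorem6 (k : ℕ) (hk : 2 ≤ k) :
    (∃ C : ℝ, ∀ n p q : ℕ, p ≤ n → q ≤ n → ∀ φ : ℝ,
      ∃ (a : ℕ) (c : PhaseCircuit.Circuit ((Fin p ⊕ Fin q) ⊕ Fin a)),
        c.Implements (PhaseCircuit.phaseProduct p q φ) ∧
        (c.depth : ℝ) ≤ C * (n : ℝ) ^ Real.logb (k : ℝ) 2 ∧
        (a : ℝ) ≤ C * (n : ℝ)) ∧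
    (∃ C : ℝ, ∀ n p q r : ℕ, p ≤ n → q ≤ n → r ≤ n → ∀ φ : ℝ,
      ∃ (a : ℕ) (c : PhaseCircuit.Circuit ((Fin p ⊕ Fin q ⊕ Fin r) ⊕ Fin a)),
        c.Implements (PhaseCircuit.phaseTripleProduct p q r φ) ∧
        (c.depth : ℝ) ≤ C * (n : ℝ) ^ Real.logb (k : ℝ) 3 ∧
        (a : ℝ) ≤ C * (n : ℝ)) := by
  have one_lt_k : (1 : ℝ) < k := by exact_mod_cast hk
  exact ⟨(mainTheorem6_general (Real.logb_pos one_lt_k one_lt_two)).1,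
    (mainTheorem6_general (Real.logb_pos one_lt_k (by norm_num))).2⟩
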